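/- Let $V:\mathbb{R}^d\to[0,+\infty)$ be continuous, with $\min V=0$ and $\liminf_{|x|\to\infty}V(x)>0$ (possibly $+\infty$). For $h>0$ let $P=P_h=-h^2\Delta+V$ be the Schrödinger operator acting in $L^2(\mathbb{R}^d)=L^2(\mathbb{R}^d;\mathbb{C})$, realized as the non-negative self-adjoint operator associated with the closed quadratic form $q_h(u)=h^2\|\nabla u\|_{L^2}^2+\|V^{1/2}u\|_{L^2}^2$ with domain $\{u\in H^1(\mathbb{R}^d): V^{1/2}u\in L^2(\mathbb{R}^d)\}$. Let $\lambda_1(P)$ be the smallest eigenvalue of $P$ if $P$ has an eigenvalue below its essential spectrum, and the bottom of the essential spectrum of $P$ otherwise. A set $E\subset\mathbb{R}^d$ is called $1$-null if the only function $f\in H^1(\mathbb{R}^d)$ with $\operatorname{supp} f\subset E$ is $f=0$. Then $$V^{-1}(\{0\})\text{ is }1\text{-null}\quad\Longleftrightarrow\quad \lim_{h\to0^+}\frac{\lambda_1(P_h)}{h^2}=+\infty .$$ -/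

import Mathlib

open Filter Topology MeasureTheory
open scoped ENNReal SchwartzMap LineDeriv ContDiff InnerProductSpace ComplexConjugate

noncomputable section

/-! ### Spectral theory of unbounded operators -/

namespace UnboundedOperator

variable {H : Type*} [NormedAddCommGroup H] [NormedSpace ℂ H]

/-- The resolvent set of a (partially defined) operator `T`: the `z` for which `T - z` is a
bijection from the domain of `T` onto `H` with a bounded everywhere defined inverse. -/
def resolventSet (T : H →ₗ.[ℂ] H) : Set ℂ :=
  {z | ∃ R : H →L[ℂ] H,
    (∀ f : H, ∃ hf : R f ∈ T.domain, T ⟨R f, hf⟩ - z • R f = f) ∧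
    ∀ u : T.domain, R (T u - z • (u : H)) = u}

/-- The spectrum. -/
def opSpectrum (T : H →ₗ.[ℂ] H) : Set ℂ := (resolventSet T)ᶜ

/-- The eigenspace `{u ∈ D(T) | T u = z u}`, as a subspace of `H`. -/
def eigenspace (T : H →ₗ.[ℂ] H) (z : ℂ) : Submodule ℂ H :=
  (LinearMap.ker (T.toFun - z • T.domain.subtype)).map T.domain.subtype

/-- `z` is an eigenvalue: there is `u ≠ 0` in `D(T)` with `T u = z u`. -/
def IsEigenvalue (T : H →ₗ.[ℂ] H) (z : ℂ) : Prop := eigenspace T z ≠ ⊥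

/-- The discrete spectrum: eigenvalues of finite multiplicity that are isolated points of the
spectrum. -/
def discreteSpectrum (T : H →ₗ.[ℂ] H) : Set ℂ :=
  {z | IsEigenvalue T z ∧ FiniteDimensional ℂ (eigenspace T z) ∧
    ∃ ε > 0, ∀ w ∈ opSpectrum T, dist w z < ε → w = z}

/-- The essential spectrum (of a self-adjoint operator): the complement of the discrete spectrum
in the spectrum. -/
def essentialSpectrum (T : H →ₗ.[ℂ] H) : Set ℂ := opSpectrum T \ discreteSpectrum T

/-- The bottom of the essential spectrum, `+∞` if the essential spectrum is empty. -/
def essentialBottom (T : H →ₗ.[ℂ] H) : EReal :=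
  sInf {y : EReal | ∃ x : ℝ, (x : ℂ) ∈ essentialSpectrum T ∧ (x : EReal) = y}

open Classical in
/-- `λ₁(T)` for a self-adjoint operator `T` that is bounded from below: the smallest eigenvalue if
`T` has an eigenvalue below the essential spectrum, and the bottom of the essential spectrum
otherwise. -/
def firstEigenvalue (T : H →ₗ.[ℂ] H) : EReal :=
  if ∃ x : ℝ, IsEigenvalue T (x : ℂ) ∧ (x : EReal) < essentialBottom T then
    sInf {y : EReal | ∃ x : ℝ, IsEigenvalue T (x : ℂ) ∧ (x : EReal) = y}
  else essentialBottom T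

end UnboundedOperator

/-! ### The Sobolev space `H¹(ℝᵈ)` and the Schrödinger operator -/

namespace Schrodinger

/-- The complex Hilbert space `L²(ℝᵈ)`. -/
abbrev L2 (d : ℕ) : Type := Lp ℂ 2 (volume : Measure (EuclideanSpace ℝ (Fin d)))

variable {d : ℕ}

/-- `g ∈ L²` is the weak (distributional) partial derivative `∂ᵢ u` of `u ∈ L²`. -/
def IsWeakPartial (i : Fin d) (u g : L2 d) : Prop :=
  ∂_{EuclideanSpace.single i (1 : ℝ)} (u : 𝓢'(EuclideanSpace ℝ (Fin d), ℂ)) =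
    (g : 𝓢'(EuclideanSpace ℝ (Fin d), ℂ))

lemma IsWeakPartial.unique {i : Fin d} {u g g' : L2 d} (h : IsWeakPartial i u g)
    (h' : IsWeakPartial i u g') : g = g' := by
  have := LinearMap.ker_eq_bot.mp
    (Lp.ker_toTemperedDistributionCLM_eq_bot (F := ℂ) (p := 2)
      (μ := (volume : Measure (EuclideanSpace ℝ (Fin d)))))
  exact this (h.symm.trans h')

lemma IsWeakPartial.add {i : Fin d} {u g u' g' : L2 d} (h : IsWeakPartial i u g)
    (h' : IsWeakPartial i u' g') : IsWeakPartial i (u + u') (g + g') := by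
  unfold IsWeakPartial at *
  simp only [← Lp.toTemperedDistributionCLM_apply] at *
  rw [map_add, map_add, LineDeriv.lineDerivOp_add, h, h']

lemma IsWeakPartial.smul {i : Fin d} {u g : L2 d} (c : ℂ) (h : IsWeakPartial i u g) :
    IsWeakPartial i (c • u) (c • g) := by
  unfold IsWeakPartial at *
  simp only [← Lp.toTemperedDistributionCLM_apply] at *
  rw [map_smul, map_smul, LineDeriv.lineDerivOp_smul, h]

variable (d) in
/-- The Sobolev space `H¹(ℝᵈ)`: the `u ∈ L²` all of whose weak partial derivatives are in `L²`. -/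
def H1 : Submodule ℂ (L2 d) where
  carrier := {u | ∀ i, ∃ g : L2 d, IsWeakPartial i u g}
  add_mem' hu hv i := by
    obtain ⟨g, hg⟩ := hu i
    obtain ⟨g', hg'⟩ := hv i
    exact ⟨g + g', hg.add hg'⟩
  zero_mem' i := ⟨0, by simpa using
    (show IsWeakPartial i (0 : L2 d) 0 by
      unfold IsWeakPartial
      rw [← Lp.toTemperedDistributionCLM_apply, map_zero, LineDeriv.lineDerivOp_zero])⟩
  smul_mem' c u hu i := by
    obtain ⟨g, hg⟩ := hu i
    exact ⟨c • g, hg.smul c⟩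

/-- The weak partial derivative `∂ᵢ : H¹ → L²`. -/
def weakPartial (i : Fin d) : H1 d →ₗ[ℂ] L2 d where
  toFun u := (u.2 i).choose
  map_add' u v :=
    ((u + v).2 i).choose_spec.unique ((u.2 i).choose_spec.add (v.2 i).choose_spec)
  map_smul' c u := ((c • u).2 i).choose_spec.unique ((u.2 i).choose_spec.smul c)

/-- A set `E ⊆ ℝᵈ` is 1-null if the only `f ∈ H¹(ℝᵈ)` with `supp f ⊆ E` is `0`. -/
def OneNull (E : Set (EuclideanSpace ℝ (Fin d))) : Prop :=
  ∀ f ∈ H1 d, Distribution.dsupport (f : 𝓢'(EuclideanSpace ℝ (Fin d), ℂ)) ⊆ E → f = 0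

/-- The form domain of `-h²Δ + V` (`h ≠ 0`, `V ≥ 0`): the `u ∈ H¹` with `V^{1/2} u ∈ L²`. -/
def formDomain (V : EuclideanSpace ℝ (Fin d) → ℝ) : Submodule ℂ (L2 d) where
  carrier := {u | u ∈ H1 d ∧ MemLp (fun x ↦ (√(V x) : ℂ) * u x) 2 volume}
  add_mem' {u v} hu hv := by
    refine ⟨add_mem hu.1 hv.1, (memLp_congr_ae ?_).1 (hu.2.add hv.2)⟩
    filter_upwards [Lp.coeFn_add u v] with x hx
    rw [hx, Pi.add_apply, Pi.add_apply, mul_add]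
  zero_mem' := by
    refine ⟨zero_mem _, (memLp_congr_ae ?_).1 (MemLp.zero (ε := ℂ))⟩
    filter_upwards [Lp.coeFn_zero ℂ 2 (volume : Measure (EuclideanSpace ℝ (Fin d)))] with x hx
    rw [hx]
    simp
  smul_mem' c u hu := by
    refine ⟨Submodule.smul_mem _ c hu.1, (memLp_congr_ae ?_).1 (hu.2.const_smul c)⟩
    filter_upwards [Lp.coeFn_smul c u] with x hx
    rw [hx, Pi.smul_apply, Pi.smul_apply, smul_eq_mul, smul_eq_mul, mul_left_comm]

/-- The function `V^{1/2} u ∈ L²`, for `u` in the form domain. -/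
def sqrtMul (V : EuclideanSpace ℝ (Fin d) → ℝ) : formDomain V →ₗ[ℂ] L2 d where
  toFun u := u.2.2.toLp _
  map_add' u v := by
    rw [← MemLp.toLp_add]
    apply MemLp.toLp_congr
    filter_upwards [Lp.coeFn_add (u : L2 d) v] with x hx
    rw [Submodule.coe_add, hx, Pi.add_apply, Pi.add_apply, mul_add]
  map_smul' c u := by
    rw [RingHom.id_apply, ← MemLp.toLp_const_smul]
    apply MemLp.toLp_congr
    filter_upwards [Lp.coeFn_smul c (u : L2 d)] with x hx
    rw [Submodule.coe_smul, hx, Pi.smul_apply, Pi.smul_apply, smul_eq_mul, smul_eq_mul,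
      mul_left_comm]

/-- The weak partial derivative `∂ᵢ u ∈ L²`, for `u` in the form domain. -/
def formPartial (V : EuclideanSpace ℝ (Fin d) → ℝ) (i : Fin d) : formDomain V →ₗ[ℂ] L2 d :=
  (weakPartial i).comp (Submodule.inclusion fun _ hu ↦ hu.1)

/-- The sesquilinear form of `-h²Δ + V`, antilinear in the first argument:
`q(u, v) = h² ∑ᵢ ⟪∂ᵢu, ∂ᵢv⟫ + ⟪V^{1/2} u, V^{1/2} v⟫`. -/
def form (h : ℝ) (V : EuclideanSpace ℝ (Fin d) → ℝ) (u v : formDomain V) : ℂ :=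
  (h : ℂ) ^ 2 * ∑ i, ⟪formPartial V i u, formPartial V i v⟫_ℂ +
    ⟪sqrtMul V u, sqrtMul V v⟫_ℂ

/-- The graph of `P = -h²Δ + V`: the pairs `(u, f)` with `u` in the form domain, `f ∈ L²`, and
`q(v, u) = ⟪v, f⟫` for all `v` in the form domain. -/
def operatorGraph (h : ℝ) (V : EuclideanSpace ℝ (Fin d) → ℝ) : Submodule ℂ (L2 d × L2 d) where
  carrier := {p | ∃ hu : p.1 ∈ formDomain V,
    ∀ v : formDomain V, form h V v ⟨p.1, hu⟩ = ⟪(v : L2 d), p.2⟫_ℂ}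
  add_mem' := by
    rintro ⟨u, f⟩ ⟨u', f'⟩ ⟨hu, hf⟩ ⟨hu', hf'⟩
    refine ⟨add_mem hu hu', fun v ↦ ?_⟩
    have e1 : ∀ i, formPartial V i ⟨u + u', add_mem hu hu'⟩ =
        formPartial V i ⟨u, hu⟩ + formPartial V i ⟨u', hu'⟩ := fun i ↦
      (formPartial V i).map_add ⟨u, hu⟩ ⟨u', hu'⟩
    have e2 : sqrtMul V ⟨u + u', add_mem hu hu'⟩ = sqrtMul V ⟨u, hu⟩ + sqrtMul V ⟨u', hu'⟩ :=
      (sqrtMul V).map_add ⟨u, hu⟩ ⟨u', hu'⟩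
    have h1 := hf v
    have h2 := hf' v
    simp only [form, Prod.mk_add_mk, e1, e2, inner_add_right, Finset.sum_add_distrib] at h1 h2 ⊢
    linear_combination h1 + h2
  zero_mem' := by
    refine ⟨zero_mem _, fun v ↦ ?_⟩
    have e1 : ∀ i, formPartial V i ⟨0, zero_mem _⟩ = 0 := fun i ↦ (formPartial V i).map_zero
    have e2 : sqrtMul V ⟨0, zero_mem _⟩ = 0 := (sqrtMul V).map_zero
    simp [form, e1, e2]
  smul_mem' := by
    rintro c ⟨u, f⟩ ⟨hu, hf⟩
    have hcu := Submodule.smul_mem _ c hu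
    refine ⟨hcu, fun v ↦ ?_⟩
    have e1 : ∀ i, formPartial V i ⟨c • u, hcu⟩ = c • formPartial V i ⟨u, hu⟩ := fun i ↦
      (formPartial V i).map_smul c ⟨u, hu⟩
    have e2 : sqrtMul V ⟨c • u, hcu⟩ = c • sqrtMul V ⟨u, hu⟩ := (sqrtMul V).map_smul c ⟨u, hu⟩
    have h1 := hf v
    simp only [form, Prod.smul_mk, e1, e2, inner_smul_right, ← Finset.mul_sum] at h1 ⊢
    linear_combination c * h1

/-- The Schrödinger operator `P = -h²Δ + V` in `L²(ℝᵈ)`, as the operator of its closed quadratic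
form: `u ∈ D(P)` and `P u = f` if and only if `(u, f)` is in `operatorGraph h V`. -/
def schrodinger (h : ℝ) (V : EuclideanSpace ℝ (Fin d) → ℝ) : L2 d →ₗ.[ℂ] L2 d :=
  (operatorGraph h V).toLinearPMap

/-- A test function, as an element of `L²`, is in the form domain. -/
lemma toLp_mem_formDomain {V : EuclideanSpace ℝ (Fin d) → ℝ} (hV : Continuous V)
    (φ : 𝓢(EuclideanSpace ℝ (Fin d), ℂ)) (hφ : HasCompactSupport φ) :
    φ.toLp 2 volume ∈ formDomain V := by
  constructor
  · intro i
    refine ⟨(∂_{EuclideanSpace.single i (1 : ℝ)} φ).toLp 2 volume, ?_⟩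
    unfold IsWeakPartial
    rw [Lp.toTemperedDistribution_toLp_eq, Lp.toTemperedDistribution_toLp_eq]
    exact TemperedDistribution.lineDerivOp_toTemperedDistributionCLM_eq _ _
  · have hc : Continuous fun x ↦ (√(V x) : ℂ) * φ x := by fun_prop
    refine (memLp_congr_ae ?_).1 (hc.memLp_of_hasCompactSupport (p := 2) (μ := volume) hφ.mul_left)
    filter_upwards [φ.coeFn_toLp 2 volume] with x hx
    simp [hx]

/-- For continuous `V` the form domain is dense, so that `operatorGraph h V` is the graph of an
operator. -/
lemma operatorGraph_functional (h : ℝ) {V : EuclideanSpace ℝ (Fin d) → ℝ} (hV : Continuous V)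
    (p : L2 d × L2 d) (hp : p ∈ operatorGraph h V) (hp0 : p.1 = 0) : p.2 = 0 := by
  obtain ⟨u, f⟩ := p
  obtain rfl : u = 0 := hp0
  obtain ⟨hu, hf⟩ := hp
  have e1 : ∀ i, formPartial V i ⟨0, zero_mem _⟩ = 0 := fun i ↦ (formPartial V i).map_zero
  have e2 : sqrtMul V ⟨0, zero_mem _⟩ = 0 := (sqrtMul V).map_zero
  simp only [form, e1, e2, inner_zero_right, Finset.sum_const_zero, mul_zero, add_zero] at hf
  change f = 0
  rw [Lp.eq_zero_iff_ae_eq_zero]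
  apply ae_eq_zero_of_integral_contDiff_smul_eq_zero
  · exact (Lp.memLp f).locallyIntegrable (by norm_num)
  · intro g g_smooth g_cpt
    have hg₁ : HasCompactSupport (Complex.ofRealCLM ∘ g) := g_cpt.comp_left rfl
    have hg₂ : ContDiff ℝ ∞ (Complex.ofRealCLM ∘ g) := by fun_prop
    have key := hf ⟨_, toLp_mem_formDomain hV (hg₁.toSchwartzMap hg₂) hg₁⟩
    rw [L2.inner_def] at key
    rw [key]
    apply integral_congr_ae
    filter_upwards [(hg₁.toSchwartzMap hg₂).coeFn_toLp 2 volume] with x hx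
    simp [hx, mul_comm]

lemma schrodinger_graph (h : ℝ) {V : EuclideanSpace ℝ (Fin d) → ℝ} (hV : Continuous V) :
    (schrodinger h V).graph = operatorGraph h V :=
  Submodule.toLinearPMap_graph_eq _ (operatorGraph_functional h hV)

end Schrodinger

end

/-! The argument has two halves: a variational description of `firstEigenvalue`, then a compactness
argument.

Variational half. Give the form domain the norm `‖u‖² + q(u)` and let `J` be its inclusion into
`L²`. Then `P + 1` is the inverse of `J J*`, and `z` lies in the spectrum of `P` exactly when `1 -
(z + 1) J J*` is not invertible. As `J J* ≥ 0` has its norm `‖J‖²` in its spectrum, the spectrum of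
`P` reaches down to `‖J‖⁻² - 1`, the infimum of `q(u) / ‖u‖²`. Any real point of the spectrum bounds
`firstEigenvalue` above, and any lower bound of the real spectrum bounds it below, so no spectral
theorem is needed. The outcome is `firstEigenvalue_schrodinger_le` and
`le_firstEigenvalue_schrodinger`.

If a nonzero `f ∈ H¹` is supported in the zero set of `V`, its potential energy vanishes, so `λ₁ /
h² ≤ ‖∇f‖² / ‖f‖²` for every `h > 0`, and the limit is not `+∞`.

Conversely, if `λ₁ / h²` does not tend to `+∞`, there are unit vectors `uₙ` and `hₙ → 0` with
`‖V^{1/2} uₙ‖² + hₙ² ‖∇uₙ‖² ≤ C hₙ²`. The gradients stay bounded and the potential energy tends to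
zero. A weak limit lives on the zero set, hence is `0` if that set is 1-null. By Rellich
(`tendsto_setIntegral_ball`) the mass on any ball tends to zero; outside a large ball `V ≥ c > 0`,
so the mass there is at most `‖V^{1/2} uₙ‖² / c → 0`. This contradicts `‖uₙ‖ = 1`
(`not_oneNull_of_tendsto`). -/

noncomputable section

namespace UnboundedOperator

/-! ### Spectrum through the resolvent at `-1` -/

section Resolvent

variable {H : Type*} [NormedAddCommGroup H] [NormedSpace ℂ H]

/-- If `R₀ = (T + 1)⁻¹`, then `z` is in the resolvent set of `T` exactly when `1 - (z + 1) R₀` is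
invertible. -/
lemma mem_resolventSet_iff {T : H →ₗ.[ℂ] H} {R₀ : H →L[ℂ] H}
    (hT : ∀ u f, (u, f) ∈ T.graph ↔ R₀ (f + u) = u) (z : ℂ) :
    z ∈ resolventSet T ↔ IsUnit (1 - (z + 1) • R₀) := by
  constructor
  · rintro ⟨R, hR₁, hR₂⟩
    rw [isUnit_iff_exists]
    -- Formally `1 - (z + 1) R₀ = (T - z)(T + 1)⁻¹`, whose inverse is `(T + 1) R = 1 + (z + 1) R`.
    refine ⟨1 + (z + 1) • R, ?_, ?_⟩
    · ext g
      obtain ⟨hu, hTu⟩ := hR₁ g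
      have hg : (R g, g + z • R g) ∈ T.graph := by
        rw [← sub_eq_iff_eq_add.mp hTu]
        exact T.mem_graph ⟨R g, hu⟩
      have h := (hT _ _).1 hg
      have e : g + z • R g + R g = g + (z + 1) • R g := by module
      rw [e] at h
      simp only [mul_apply_eq_comp, sub_apply,
        one_apply_eq_self, add_apply,
        smul_apply, h]
      abel
    · ext g
      have hg : (R₀ g, g - R₀ g) ∈ T.graph := by rw [hT, sub_add_cancel]
      obtain ⟨y, hy₁, hy₂⟩ := T.mem_graph_iff.1 hg
      have h := hR₂ y
      simp only at hy₁ hy₂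
      rw [hy₁, hy₂] at h
      have e : g - R₀ g - z • R₀ g = g - (z + 1) • R₀ g := by module
      rw [e] at h
      simp only [mul_apply_eq_comp, sub_apply,
        one_apply_eq_self, add_apply,
        smul_apply, h]
      abel
  · intro hS
    obtain ⟨S, hS₁, hS₂⟩ := isUnit_iff_exists.1 hS
    have h₁ : ∀ f, S f - (z + 1) • R₀ (S f) = f := fun f ↦ by
      simpa using DFunLike.congr_fun hS₁ f
    have h₂ : ∀ f, S (f - (z + 1) • R₀ f) = f := fun f ↦ by
      simpa using DFunLike.congr_fun hS₂ f
    refine ⟨R₀ * S, fun f ↦ ?_, fun u ↦ ?_⟩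
    · have hg : (R₀ (S f), f + z • R₀ (S f)) ∈ T.graph := by
        rw [hT]
        have e : f + z • R₀ (S f) + R₀ (S f) = f + (z + 1) • R₀ (S f) := by module
        rw [e, ← sub_eq_iff_eq_add.mp (h₁ f)]
      obtain ⟨y, hy₁, hy₂⟩ := T.mem_graph_iff.1 hg
      simp only at hy₁ hy₂
      refine ⟨by simpa only [mul_apply_eq_comp, ← hy₁] using y.2, ?_⟩
      have : T ⟨(R₀ * S) f, by simpa only [mul_apply_eq_comp, ← hy₁] using y.2⟩
          = T y := congrArg T (Subtype.ext hy₁.symm)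
      rw [this, hy₂]
      simp
    · have h := (hT _ _).1 (T.mem_graph u)
      have e : T u - z • (u : H) = (T u + u) - (z + 1) • R₀ (T u + u) := by rw [h]; module
      rw [mul_apply_eq_comp, e, h₂, h]

lemma IsEigenvalue.mem_opSpectrum {T : H →ₗ.[ℂ] H} {z : ℂ} (hz : IsEigenvalue T z) :
    z ∈ opSpectrum T := by
  rintro ⟨R, -, hR⟩
  obtain ⟨v, hv, hv0⟩ := Submodule.exists_mem_ne_zero_of_ne_bot hz
  obtain ⟨u, hu, rfl⟩ := hv
  apply hv0
  have h : T u - z • (u : H) = 0 := hu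
  have := hR u
  rw [h, map_zero] at this
  exact this.symm

/-- A spectral point below the essential spectrum is discrete, hence an eigenvalue; any other is at
least `essentialBottom`, which dominates both branches of the definition. -/
lemma firstEigenvalue_le_of_mem_opSpectrum {T : H →ₗ.[ℂ] H} {x : ℝ}
    (hx : (x : ℂ) ∈ opSpectrum T) : firstEigenvalue T ≤ x := by
  by_cases hlt : (x : EReal) < essentialBottom T
  · have hdisc : (x : ℂ) ∈ discreteSpectrum T := by
      by_contra h
      have : essentialBottom T ≤ x := sInf_le ⟨x, ⟨hx, h⟩, rfl⟩
      exact hlt.not_ge this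
    rw [firstEigenvalue, if_pos ⟨x, hdisc.1, hlt⟩]
    exact sInf_le ⟨x, hdisc.1, rfl⟩
  · rw [not_lt] at hlt
    refine le_trans ?_ hlt
    rw [firstEigenvalue]
    split_ifs with h
    · obtain ⟨y, hy, hy'⟩ := h
      exact le_trans (b := (y : EReal)) (sInf_le ⟨y, hy, rfl⟩) hy'.le
    · exact le_rfl

lemma le_firstEigenvalue {T : H →ₗ.[ℂ] H} {c : EReal}
    (hc : ∀ x : ℝ, (x : ℂ) ∈ opSpectrum T → c ≤ x) : c ≤ firstEigenvalue T := by
  rw [firstEigenvalue]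
  split_ifs
  · refine le_sInf ?_
    rintro _ ⟨x, hx, rfl⟩
    exact hc x hx.mem_opSpectrum
  · refine le_sInf ?_
    rintro _ ⟨x, hx, rfl⟩
    exact hc x hx.1

end Resolvent

/-! ### Variational bounds when `T + 1 = (J J*)⁻¹` -/

section Form

variable {H K : Type*} [NormedAddCommGroup H] [InnerProductSpace ℂ H] [CompleteSpace H]
  [NormedAddCommGroup K] [InnerProductSpace ℂ K] [CompleteSpace K]

open ContinuousLinearMap in
lemma norm_comp_adjoint_self (J : K →L[ℂ] H) : ‖J ∘L adjoint J‖ = ‖J‖ ^ 2 := by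
  have := norm_adjoint_comp_self (adjoint J)
  rw [adjoint_adjoint] at this
  rw [this, LinearIsometryEquiv.norm_map, sq]

open ContinuousLinearMap in
lemma nonneg_comp_adjoint_self (J : K →L[ℂ] H) : 0 ≤ J ∘L adjoint J := by
  rw [nonneg_iff_isPositive]
  exact isPositive_self_comp_adjoint J

/-- The variational upper bound. -/
lemma firstEigenvalue_le {T : H →ₗ.[ℂ] H} {J : K →L[ℂ] H}
    (hT : ∀ u f, (u, f) ∈ T.graph ↔ J (ContinuousLinearMap.adjoint J (f + u)) = u)
    {k : K} (hk : J k ≠ 0) :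
    firstEigenvalue T ≤ ((‖k‖ ^ 2 / ‖J k‖ ^ 2 - 1 : ℝ) : EReal) := by
  have : Nontrivial H := ⟨⟨_, _, hk⟩⟩
  set R₀ := J ∘L ContinuousLinearMap.adjoint J with hR₀
  have hk' : 0 < ‖J k‖ := norm_pos_iff.2 hk
  have hJ : 0 < ‖J‖ := norm_pos_iff.2 (by rintro rfl; simp at hk)
  -- The norm of a positive operator belongs to its spectrum; `x ↦ x⁻¹ - 1` carries it to a spectral
  -- point of `T`.
  have hspec : ((‖R₀‖ : ℝ) : ℂ) ∈ spectrum ℂ R₀ := by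
    have := CStarAlgebra.norm_mem_spectrum_of_nonneg (nonneg_comp_adjoint_self J)
    exact spectrum.algebraMap_mem ℂ this
  have hx : (((‖J‖ ^ 2)⁻¹ - 1 : ℝ) : ℂ) ∈ opSpectrum T := by
    intro hres
    rw [mem_resolventSet_iff (R₀ := R₀) hT] at hres
    apply hspec
    rw [norm_comp_adjoint_self, spectrum.mem_resolventSet_iff]
    have hne : ((‖J‖ ^ 2 : ℝ) : ℂ) ≠ 0 := by exact_mod_cast (pow_pos hJ 2).ne'
    have := (IsUnit.mk0 _ hne).map (algebraMap ℂ (H →L[ℂ] H)) |>.mul hres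
    convert! this using 1
    rw [mul_sub, mul_one, ← Algebra.smul_def, smul_smul]
    congr 1
    rw [show ((‖J‖ ^ 2 : ℝ) : ℂ) * (((‖J‖ ^ 2)⁻¹ - 1 : ℝ) + 1) = 1 by
      rw [← Complex.ofReal_one, ← Complex.ofReal_add, ← Complex.ofReal_mul, sub_add_cancel,
        mul_inv_cancel₀ (pow_pos hJ 2).ne'], one_smul]
  refine (firstEigenvalue_le_of_mem_opSpectrum hx).trans ?_
  norm_cast
  gcongr
  rw [inv_le_comm₀ (by positivity) (by
    have : ‖k‖ ≠ 0 := by rintro h; simp [norm_eq_zero.1 h] at hk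
    positivity), inv_div]
  have := J.le_opNorm k
  apply div_le_of_le_mul₀ (by positivity) (by positivity)
  rw [← mul_pow]
  gcongr

/-- The variational lower bound. -/
lemma le_firstEigenvalue_of_form {T : H →ₗ.[ℂ] H} {J : K →L[ℂ] H}
    (hT : ∀ u f, (u, f) ∈ T.graph ↔ J (ContinuousLinearMap.adjoint J (f + u)) = u)
    {c : ℝ} (hc : 0 < c) (hJ : ∀ k, c * ‖J k‖ ^ 2 ≤ ‖k‖ ^ 2) :
    ((c - 1 : ℝ) : EReal) ≤ firstEigenvalue T := by
  set R₀ := J ∘L ContinuousLinearMap.adjoint J with hR₀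
  have hnorm : ‖R₀‖ ≤ c⁻¹ := by
    rw [norm_comp_adjoint_self]
    have : ‖J‖ ≤ √(c⁻¹) := by
      refine J.opNorm_le_bound (by positivity) fun k ↦ ?_
      rw [← Real.sqrt_sq (norm_nonneg k), ← Real.sqrt_mul (by positivity)]
      apply Real.le_sqrt_of_sq_le
      rw [inv_mul_eq_div, le_div_iff₀ hc, mul_comm]
      exact hJ k
    calc ‖J‖ ^ 2 ≤ √(c⁻¹) ^ 2 := by gcongr
      _ = c⁻¹ := Real.sq_sqrt (by positivity)
  refine le_firstEigenvalue fun x hx ↦ ?_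
  norm_cast
  rw [opSpectrum, Set.mem_compl_iff, mem_resolventSet_iff (R₀ := R₀) hT] at hx
  -- The point `-1` is in the resolvent set, since there `1 - (x + 1) R₀` is the identity.
  have hx1 : x + 1 ≠ 0 := by
    intro h
    apply hx
    have : ((x : ℂ) + 1) = 0 := by exact_mod_cast h
    simp [this]
  have hspec : (x + 1)⁻¹ ∈ spectrum ℝ R₀ := by
    rw [← spectrum.algebraMap_mem_iff ℂ]
    intro h
    apply hx
    rw [spectrum.mem_resolventSet_iff] at h
    have hne : (x : ℂ) + 1 ≠ 0 := by exact_mod_cast hx1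
    have := (IsUnit.mk0 _ hne).map (algebraMap ℂ (H →L[ℂ] H)) |>.mul h
    convert! this using 1
    rw [mul_sub, ← map_mul, ← Algebra.smul_def]
    congr 1
    simp [hne]
  have hpos : 0 ≤ (x + 1)⁻¹ := spectrum_nonneg_of_nonneg (nonneg_comp_adjoint_self J) hspec
  have hle : (x + 1)⁻¹ ≤ c⁻¹ := by
    -- `H` may be trivial here, so only `‖1‖ ≤ 1` is available.
    have h1 := spectrum.norm_le_norm_mul_of_mem hspec
    have h2 : ‖(1 : H →L[ℂ] H)‖ ≤ 1 := ContinuousLinearMap.norm_id_le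
    have : ‖R₀‖ * ‖(1 : H →L[ℂ] H)‖ ≤ ‖R₀‖ := mul_le_of_le_one_right (norm_nonneg _) h2
    exact (le_abs_self _).trans (h1.trans (this.trans hnorm))
  have h0 : 0 < x + 1 := lt_of_le_of_ne (inv_nonneg.1 hpos) hx1.symm
  have := (inv_le_inv₀ h0 hc).1 hle
  linarith

end Form

end UnboundedOperator

namespace Schrodinger

variable {d : ℕ}

/-! ### The Schrödinger form as a Hilbert space -/

lemma isWeakPartial_weakPartial (i : Fin d) (u : H1 d) : IsWeakPartial i u (weakPartial i u) :=
  (u.2 i).choose_spec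

/-- Both the embedding of `L²` into tempered distributions and distributional differentiation are
continuous. -/
lemma isClosed_setOf_isWeakPartial (i : Fin d) :
    IsClosed {p : L2 d × L2 d | IsWeakPartial i p.1 p.2} := by
  apply isClosed_eq
  · exact (LineDeriv.lineDerivOpCLM ℂ 𝓢'(EuclideanSpace ℝ (Fin d), ℂ)
      (EuclideanSpace.single i (1 : ℝ)) ∘L Lp.toTemperedDistributionCLM ℂ volume 2).continuous.comp
      continuous_fst
  · exact (Lp.toTemperedDistributionCLM ℂ volume 2).continuous.comp continuous_snd

/-- Convergence in `L²` gives almost everywhere convergence of a subsequence. -/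
lemma exists_subseq_tendsto_ae {α : Type*} {m : MeasurableSpace α} {μ : Measure α}
    {u : ℕ → Lp ℂ 2 μ} {v : Lp ℂ 2 μ} (h : Tendsto u atTop (𝓝 v)) :
    ∃ φ : ℕ → ℕ, StrictMono φ ∧ ∀ᵐ x ∂μ, Tendsto (fun n ↦ u (φ n) x) atTop (𝓝 (v x)) :=
  (tendstoInMeasure_of_tendsto_Lp h).exists_seq_tendsto_ae

/-- Multiplication by a measurable function is a closed operator in `L²`. -/
lemma isClosed_setOf_mul_ae_eq {α : Type*} {m : MeasurableSpace α} {μ : Measure α} (a : α → ℂ) :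
    IsClosed {p : Lp ℂ 2 μ × Lp ℂ 2 μ | (fun x ↦ a x * p.1 x) =ᵐ[μ] p.2} := by
  rw [← isSeqClosed_iff_isClosed]
  intro p q hp hpq
  -- Almost everywhere convergence of the first components, then of the second along a further
  -- subsequence.
  obtain ⟨φ, hφ, h₁⟩ := exists_subseq_tendsto_ae ((continuous_fst.tendsto q).comp hpq)
  obtain ⟨ψ, hψ, h₂⟩ := exists_subseq_tendsto_ae
    (((continuous_snd.tendsto q).comp hpq).comp hφ.tendsto_atTop)
  have h₃ : ∀ᵐ x ∂μ, ∀ n, a x * (p n).1 x = (p n).2 x := ae_all_iff.2 hp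
  filter_upwards [h₁, h₂, h₃] with x h₁ h₂ h₃
  refine tendsto_nhds_unique ((h₁.comp hψ.tendsto_atTop).const_mul (a x)) (h₂.congr fun n ↦ ?_)
  simp [h₃]

lemma sqrtMul_ae_eq (V : EuclideanSpace ℝ (Fin d) → ℝ) (u : formDomain V) :
    (fun x ↦ (√(V x) : ℂ) * (u : L2 d) x) =ᵐ[volume] sqrtMul V u :=
  u.2.2.coeFn_toLp.symm

variable (d) in
/-- The Hilbert space of triples `(u, w, (gᵢ))` of elements of `L²`. -/
abbrev Ambient : Type := PiLp 2 fun _ : Option (Option (Fin d)) ↦ L2 d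

/-- The map `u ↦ (u, V^{1/2} u, h ∇u)` on the form domain. -/
def energyMap (h : ℝ) (V : EuclideanSpace ℝ (Fin d) → ℝ) : formDomain V →ₗ[ℂ] Ambient d where
  toFun u := WithLp.toLp 2 fun
    | none => u
    | some none => sqrtMul V u
    | some (some i) => (h : ℂ) • formPartial V i u
  map_add' u v := by
    ext1 i
    rcases i with _ | _ | i <;> simp
  map_smul' c u := by
    ext1 i
    rcases i with _ | _ | i
    · simp
    · simp
    · change (h : ℂ) • formPartial V i (c • u) = c • (h : ℂ) • formPartial V i u
      rw [map_smul, smul_comm]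

variable {h : ℝ} {V : EuclideanSpace ℝ (Fin d) → ℝ}

@[simp] lemma energyMap_none (u : formDomain V) : energyMap h V u none = u := rfl

@[simp] lemma energyMap_some_none (u : formDomain V) :
    energyMap h V u (some none) = sqrtMul V u := rfl

@[simp] lemma energyMap_some_some (u : formDomain V) (i : Fin d) :
    energyMap h V u (some (some i)) = (h : ℂ) • formPartial V i u := rfl

lemma inner_energyMap (u v : formDomain V) :
    ⟪energyMap h V u, energyMap h V v⟫_ℂ = ⟪(u : L2 d), (v : L2 d)⟫_ℂ + form h V u v := by
  rw [PiLp.inner_apply, Fintype.sum_option, Fintype.sum_option]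
  simp only [energyMap_none, energyMap_some_none, energyMap_some_some, inner_smul_left,
    inner_smul_right, form, Finset.mul_sum, Complex.conj_ofReal]
  congr 1
  rw [add_comm]
  congr 1
  exact Finset.sum_congr rfl fun i _ ↦ by ring

lemma norm_sq_energyMap (u : formDomain V) :
    ‖energyMap h V u‖ ^ 2 = ‖(u : L2 d)‖ ^ 2 +
      (‖sqrtMul V u‖ ^ 2 + h ^ 2 * ∑ i, ‖formPartial V i u‖ ^ 2) := by
  rw [PiLp.norm_sq_eq_of_L2, Fintype.sum_option, Fintype.sum_option]
  simp only [energyMap_none, energyMap_some_none, energyMap_some_some, norm_smul, mul_pow,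
    Finset.mul_sum, Complex.norm_real, Real.norm_eq_abs, sq_abs]

/-- Membership becomes a list of conditions on the components, each stable under `L²` limits. This
yields completeness of the form domain, i.e. closedness of the form. -/
lemma mem_range_energyMap_iff (hh : h ≠ 0) (p : Ambient d) :
    p ∈ LinearMap.range (energyMap h V) ↔
      (fun x ↦ (√(V x) : ℂ) * p none x) =ᵐ[volume] p (some none) ∧
        ∀ i, IsWeakPartial i (p none) ((h : ℂ)⁻¹ • p (some (some i))) := by
  have hh' : (h : ℂ) ≠ 0 := by exact_mod_cast hh
  constructor
  · rintro ⟨u, rfl⟩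
    refine ⟨sqrtMul_ae_eq V u, fun i ↦ ?_⟩
    simp only [energyMap_none, energyMap_some_some, inv_smul_smul₀ hh']
    exact isWeakPartial_weakPartial i ⟨u, u.2.1⟩
  · rintro ⟨h₁, h₂⟩
    have h₃ : p none ∈ formDomain V :=
      ⟨fun i ↦ ⟨_, h₂ i⟩, (memLp_congr_ae h₁).2 (Lp.memLp _)⟩
    refine ⟨⟨p none, h₃⟩, ?_⟩
    ext1 i
    rcases i with _ | _ | i
    · rfl
    · exact Lp.ext ((sqrtMul_ae_eq V ⟨p none, h₃⟩).symm.trans h₁)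
    · have := (isWeakPartial_weakPartial i ⟨p none, h₃.1⟩).unique (h₂ i)
      change (h : ℂ) • weakPartial i ⟨p none, h₃.1⟩ = _
      rw [this, smul_inv_smul₀ hh']

lemma isClosed_range_energyMap (hh : h ≠ 0) :
    IsClosed (LinearMap.range (energyMap h V) : Set (Ambient d)) := by
  have : (LinearMap.range (energyMap h V) : Set (Ambient d)) =
      {p | (fun x ↦ (√(V x) : ℂ) * p none x) =ᵐ[volume] p (some none)} ∩
        ⋂ i, {p | IsWeakPartial i (p none) ((h : ℂ)⁻¹ • p (some (some i)))} := by
    ext p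
    simpa using mem_range_energyMap_iff hh p
  rw [this]
  have hc : ∀ j, Continuous fun p : Ambient d ↦ p j := fun j ↦ by fun_prop
  refine .inter ?_ (isClosed_iInter fun i ↦ ?_)
  · have h₁ : Continuous fun p : Ambient d ↦ (p none, p (some none)) :=
      (hc none).prodMk (hc (some none))
    exact IsClosed.preimage h₁ (isClosed_setOf_mul_ae_eq fun x ↦ (√(V x) : ℂ))
  · have h₁ : Continuous fun p : Ambient d ↦ (p none, (h : ℂ)⁻¹ • p (some (some i))) :=
      (hc none).prodMk ((hc (some (some i))).fun_const_smul _)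
    exact IsClosed.preimage h₁ (isClosed_setOf_isWeakPartial i)

/-- The projection `(u, V^{1/2} u, h ∇u) ↦ u`. -/
def energyProj (h : ℝ) (V : EuclideanSpace ℝ (Fin d) → ℝ) :
    LinearMap.range (energyMap h V) →L[ℂ] L2 d :=
  PiLp.proj 2 (fun _ : Option (Option (Fin d)) ↦ L2 d) none ∘L Submodule.subtypeL _

lemma energyProj_rangeRestrict (u : formDomain V) :
    energyProj h V ((energyMap h V).rangeRestrict u) = u := rfl

lemma norm_sq_rangeRestrict_energyMap (u : formDomain V) :
    ‖(energyMap h V).rangeRestrict u‖ ^ 2 = ‖(u : L2 d)‖ ^ 2 +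
      (‖sqrtMul V u‖ ^ 2 + h ^ 2 * ∑ i, ‖formPartial V i u‖ ^ 2) :=
  norm_sq_energyMap u

lemma inner_rangeRestrict_energyMap (u v : formDomain V) :
    ⟪(energyMap h V).rangeRestrict u, (energyMap h V).rangeRestrict v⟫_ℂ =
      ⟪(u : L2 d), (v : L2 d)⟫_ℂ + form h V u v :=
  inner_energyMap u v

lemma completeSpace_range_energyMap (hh : h ≠ 0) (V : EuclideanSpace ℝ (Fin d) → ℝ) :
    CompleteSpace (LinearMap.range (energyMap h V)) :=
  (isClosed_range_energyMap hh).completeSpace_coe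

/-- With `J = energyProj h V`, the vector `J* g` is the Riesz representative of `v ↦ ⟪v, g⟫` for the
inner product `⟪v, u⟫ + q(v, u)`. So `J J* (f + u) = u` says `q(v, u) + ⟪v, u⟫ = ⟪v, f + u⟫` for all
`v`. -/
lemma mem_graph_schrodinger_iff (hV : Continuous V)
    [CompleteSpace (LinearMap.range (energyMap h V))] (u f : L2 d) :
    (u, f) ∈ (schrodinger h V).graph ↔
      energyProj h V (ContinuousLinearMap.adjoint (energyProj h V) (f + u)) = u := by
  rw [schrodinger_graph h hV]
  constructor
  · rintro ⟨hu, hf⟩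
    have : ContinuousLinearMap.adjoint (energyProj h V) (f + u) =
        (energyMap h V).rangeRestrict ⟨u, hu⟩ := by
      refine ext_inner_left ℂ ?_
      intro k
      obtain ⟨v, rfl⟩ := (energyMap h V).surjective_rangeRestrict k
      rw [ContinuousLinearMap.adjoint_inner_right, energyProj_rangeRestrict,
        inner_rangeRestrict_energyMap, hf v,
        inner_add_right, add_comm]
    rw [this, energyProj_rangeRestrict]
  · intro hu
    obtain ⟨w, hw⟩ := (energyMap h V).surjective_rangeRestrict
      (ContinuousLinearMap.adjoint (energyProj h V) (f + u))
    rw [← hw, energyProj_rangeRestrict] at hu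
    subst hu
    refine ⟨w.2, fun v ↦ ?_⟩
    have := ContinuousLinearMap.adjoint_inner_right (energyProj h V)
      ((energyMap h V).rangeRestrict v) (f + w)
    rw [← hw, energyProj_rangeRestrict,
        inner_rangeRestrict_energyMap,
        inner_add_right, add_comm] at this
    exact add_right_cancel this

theorem firstEigenvalue_schrodinger_le (hh : h ≠ 0) (hV : Continuous V) (u : formDomain V)
    (hu : u ≠ 0) :
    UnboundedOperator.firstEigenvalue (schrodinger h V) ≤
      (((‖sqrtMul V u‖ ^ 2 + h ^ 2 * ∑ i, ‖formPartial V i u‖ ^ 2) / ‖(u : L2 d)‖ ^ 2 : ℝ) :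
        EReal) := by
  have := completeSpace_range_energyMap hh V
  have hu' : (u : L2 d) ≠ 0 := by simpa using hu
  have hn : ‖(u : L2 d)‖ ^ 2 ≠ 0 := by simpa using hu
  have key := UnboundedOperator.firstEigenvalue_le (mem_graph_schrodinger_iff (h := h) hV)
    (k := (energyMap h V).rangeRestrict u) hu'
  rwa [energyProj_rangeRestrict, norm_sq_rangeRestrict_energyMap, add_div, div_self hn,
    add_sub_cancel_left] at key

theorem le_firstEigenvalue_schrodinger (hh : h ≠ 0) (hV : Continuous V) {c : ℝ} (hc : 0 ≤ c)
    (H : ∀ u : formDomain V, c * ‖(u : L2 d)‖ ^ 2 ≤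
      ‖sqrtMul V u‖ ^ 2 + h ^ 2 * ∑ i, ‖formPartial V i u‖ ^ 2) :
    (c : EReal) ≤ UnboundedOperator.firstEigenvalue (schrodinger h V) := by
  have := completeSpace_range_energyMap hh V
  -- The form norm contains an extra `‖u‖²`, hence the constant `c + 1`.
  have key := UnboundedOperator.le_firstEigenvalue_of_form
    (mem_graph_schrodinger_iff (h := h) hV) (c := c + 1) (by positivity) fun k ↦ by
      obtain ⟨u, rfl⟩ := (energyMap h V).surjective_rangeRestrict k
      rw [energyProj_rangeRestrict, norm_sq_rangeRestrict_energyMap]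
      linarith [H u]
  rwa [add_sub_cancel_right] at key

/-! ### Rellich's theorem by frequency splitting -/

open scoped FourierTransform RealInnerProductSpace

lemma norm_sq_eq_integral {α : Type*} {m : MeasurableSpace α} {μ : Measure α} (f : Lp ℂ 2 μ) :
    ‖f‖ ^ 2 = ∫ x, ‖f x‖ ^ 2 ∂μ := by
  have h := inner_self_eq_norm_sq_to_K (𝕜 := ℂ) f
  rw [L2.inner_def] at h
  simp only [inner_self_eq_norm_sq_to_K] at h
  have : ∫ x, (((‖f x‖ ^ 2 : ℝ)) : ℂ) ∂μ = ((‖f‖ ^ 2 : ℝ) : ℂ) := by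
    push_cast
    exact h
  rw [integral_complex_ofReal] at this
  exact_mod_cast this.symm

lemma integrable_norm_sq {α : Type*} {m : MeasurableSpace α} {μ : Measure α} (f : Lp ℂ 2 μ) :
    Integrable (fun x ↦ ‖f x‖ ^ 2) μ :=
  (Lp.memLp f).integrable_norm_pow (p := 2) two_ne_zero

/-- Two locally integrable functions that agree as tempered distributions agree almost
everywhere. -/
lemma ae_eq_of_integral_schwartz {f g : EuclideanSpace ℝ (Fin d) → ℂ}
    (hf : LocallyIntegrable f) (hg : LocallyIntegrable g)
    (H : ∀ φ : 𝓢(EuclideanSpace ℝ (Fin d), ℂ), ∫ x, φ x * f x = ∫ x, φ x * g x) :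
    f =ᵐ[volume] g := by
  refine ae_eq_of_integral_contDiff_smul_eq hf hg fun φ hφ hc ↦ ?_
  have hφ₁ : HasCompactSupport (Complex.ofRealCLM ∘ φ) := hc.comp_left rfl
  have hφ₂ : ContDiff ℝ ∞ (Complex.ofRealCLM ∘ φ) := by fun_prop
  simpa using! H (hφ₁.toSchwartzMap hφ₂)

/-- The Fourier transform turns weak derivatives into multiplications. -/
lemma IsWeakPartial.fourier_ae_eq {i : Fin d} {u g : L2 d} (h : IsWeakPartial i u g) :
    (𝓕 g : L2 d) =ᵐ[volume] fun ξ ↦ (2 * Real.pi * Complex.I * ξ i) * (𝓕 u : L2 d) ξ := by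
  have hu : LocallyIntegrable (𝓕 u : L2 d) (volume : Measure (EuclideanSpace ℝ (Fin d))) :=
    (Lp.memLp _).locallyIntegrable (by norm_num)
  refine ae_eq_of_integral_schwartz ((Lp.memLp _).locallyIntegrable (by norm_num))
    (hu.continuous_mul (by fun_prop)) fun φ ↦ ?_
  have h₁ := TemperedDistribution.fourier_lineDerivOp_eq
    (u : 𝓢'(EuclideanSpace ℝ (Fin d), ℂ)) (EuclideanSpace.single i (1 : ℝ))
  rw [h, Lp.fourier_toTemperedDistribution_eq, Lp.fourier_toTemperedDistribution_eq] at h₁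
  have h₂ := DFunLike.congr_fun h₁ φ
  rw [Lp.toTemperedDistribution_apply] at h₂
  simp only [smul_eq_mul] at h₂
  rw [h₂]
  have ht : (fun x : EuclideanSpace ℝ (Fin d) ↦
      ((inner ℝ x (EuclideanSpace.single i (1 : ℝ)) : ℝ) : ℂ)).HasTemperateGrowth := by fun_prop
  change (2 * Real.pi * Complex.I) • Lp.toTemperedDistribution (𝓕 u : L2 d)
    (SchwartzMap.smulLeftCLM ℂ _ φ) = _
  rw [Lp.toTemperedDistribution_apply, ← integral_smul]
  refine integral_congr_ae (ae_of_all _ fun ξ ↦ ?_)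
  simp only [SchwartzMap.smulLeftCLM_apply_apply ht, smul_eq_mul]
  simp [EuclideanSpace.inner_single_right]
  ring

/-- The high frequencies of a function are controlled by its gradient. -/
lemma setIntegral_fourier_le {u : L2 d} {g : Fin d → L2 d} (hg : ∀ i, IsWeakPartial i u (g i))
    {K : ℝ} (hK : 0 < K) :
    ∫ ξ in (Metric.ball 0 K)ᶜ, ‖(𝓕 u : L2 d) ξ‖ ^ 2 ≤ (∑ i, ‖g i‖ ^ 2) / K ^ 2 := by
  have hint : Integrable (fun ξ ↦ (∑ i, ‖(𝓕 (g i) : L2 d) ξ‖ ^ 2) / K ^ 2) volume :=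
    (integrable_finsetSum _ fun i _ ↦ integrable_norm_sq _).div_const _
  calc ∫ ξ in (Metric.ball 0 K)ᶜ, ‖(𝓕 u : L2 d) ξ‖ ^ 2
      ≤ ∫ ξ in (Metric.ball 0 K)ᶜ, (∑ i, ‖(𝓕 (g i) : L2 d) ξ‖ ^ 2) / K ^ 2 := by
        refine setIntegral_mono_on_ae (integrable_norm_sq _).integrableOn hint.integrableOn
          Metric.isOpen_ball.measurableSet.compl ?_
        filter_upwards [ae_all_iff.2 fun i ↦ (hg i).fourier_ae_eq] with ξ hξ hξK
        have hξK' : K ≤ ‖ξ‖ := by simpa using hξK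
        rw [le_div_iff₀ (by positivity)]
        calc ‖(𝓕 u : L2 d) ξ‖ ^ 2 * K ^ 2 ≤ ‖(𝓕 u : L2 d) ξ‖ ^ 2 * ‖ξ‖ ^ 2 := by gcongr
          _ = ∑ i, ‖(ξ i : ℂ) * (𝓕 u : L2 d) ξ‖ ^ 2 := by
            rw [EuclideanSpace.norm_sq_eq, Finset.mul_sum]
            refine Finset.sum_congr rfl fun i _ ↦ ?_
            rw [norm_mul, mul_pow, mul_comm, Complex.norm_real]
          _ ≤ ∑ i, ‖(𝓕 (g i) : L2 d) ξ‖ ^ 2 := by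
            refine Finset.sum_le_sum fun i _ ↦ ?_
            rw [hξ i, mul_assoc, norm_mul _ ((ξ i : ℂ) * _)]
            gcongr
            -- The factor `2π` of the Fourier convention is discarded; only `1 ≤ 2π` matters.
            apply le_mul_of_one_le_left (norm_nonneg _)
            simp only [norm_mul, Complex.norm_I, Complex.norm_real, Complex.norm_ofNat, mul_one,
              Real.norm_eq_abs, abs_of_pos Real.pi_pos]
            linarith [Real.two_le_pi]
    _ ≤ ∫ ξ, (∑ i, ‖(𝓕 (g i) : L2 d) ξ‖ ^ 2) / K ^ 2 :=
        setIntegral_le_integral hint (ae_of_all _ fun ξ ↦ by positivity)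
    _ = (∑ i, ‖g i‖ ^ 2) / K ^ 2 := by
        rw [integral_div, integral_finsetSum _ fun i _ ↦ integrable_norm_sq _]
        simp only [← norm_sq_eq_integral, Lp.norm_fourier_eq]

/-- For an integrable square integrable function the inverse Fourier transform on `L²` is given by
the integral. -/
lemma fourierInv_toLp_ae_eq {w : EuclideanSpace ℝ (Fin d) → ℂ} (hw₁ : Integrable w)
    (hw₂ : MemLp w 2) : (𝓕⁻ (hw₂.toLp w) : L2 d) =ᵐ[volume] 𝓕⁻ w := by
  have hcont : Continuous (𝓕⁻ w) :=
    VectorFourier.fourierIntegral_continuous Real.continuous_fourierChar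
      (L := -innerₗ (EuclideanSpace ℝ (Fin d))) (by simpa using! continuous_inner.neg) hw₁
  refine ae_eq_of_integral_schwartz ((Lp.memLp _).locallyIntegrable (by norm_num))
    hcont.locallyIntegrable fun φ ↦ ?_
  have h₁ := DFunLike.congr_fun
    (Lp.fourierInv_toTemperedDistribution_eq (hw₂.toLp w : L2 d)) φ
  rw [TemperedDistribution.fourierInv_apply, Lp.toTemperedDistribution_apply,
    Lp.toTemperedDistribution_apply] at h₁
  simp only [smul_eq_mul] at h₁
  rw [← h₁]
  have h₂ := VectorFourier.integral_fourierIntegral_smul_eq_flip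
    (L := -innerₗ (EuclideanSpace ℝ (Fin d))) (μ := volume) (ν := volume)
    Real.continuous_fourierChar (by simpa using! continuous_inner.neg) φ.integrable hw₁
  have h₃ : (-innerₗ (EuclideanSpace ℝ (Fin d))).flip = -innerₗ (EuclideanSpace ℝ (Fin d)) := by
    ext x y
    simp [real_inner_comm]
  rw [h₃] at h₂
  refine Eq.trans ?_ h₂
  refine integral_congr_ae ?_
  filter_upwards [hw₂.coeFn_toLp] with ξ hξ
  rw [hξ, SchwartzMap.fourierInv_coe]
  rfl

/-- The plane wave `ξ ↦ e^{-2πi⟨ξ, x⟩}`, cut off outside of a ball. -/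
def cutWave (K : ℝ) (x ξ : EuclideanSpace ℝ (Fin d)) : ℂ :=
  (Metric.ball 0 K).indicator (fun ξ ↦ (Real.fourierChar (-⟪ξ, x⟫) : ℂ)) ξ

lemma norm_cutWave_le (K : ℝ) (x ξ : EuclideanSpace ℝ (Fin d)) :
    ‖cutWave K x ξ‖ ≤ ‖(Metric.ball 0 K).indicator (fun _ ↦ (1 : ℂ)) ξ‖ := by
  rw [cutWave, norm_indicator_eq_indicator_norm, norm_indicator_eq_indicator_norm]
  refine Set.indicator_le_indicator ?_
  rw [Circle.norm_coe, norm_one]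

lemma memLp_indicator_ball (K : ℝ) : MemLp
    ((Metric.ball (0 : EuclideanSpace ℝ (Fin d)) K).indicator (fun _ ↦ (1 : ℂ))) 2 volume :=
  memLp_indicator_const 2 Metric.isOpen_ball.measurableSet 1 (.inr measure_ball_lt_top.ne)

lemma memLp_cutWave (K : ℝ) (x : EuclideanSpace ℝ (Fin d)) : MemLp (cutWave K x) 2 volume := by
  refine (memLp_indicator_ball K).mono ?_ (ae_of_all _ (norm_cutWave_le K x))
  refine AEStronglyMeasurable.indicator ?_ Metric.isOpen_ball.measurableSet
  exact (by fun_prop : Continuous fun ξ : EuclideanSpace ℝ (Fin d) ↦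
    (Real.fourierChar (-⟪ξ, x⟫) : ℂ)).aestronglyMeasurable

/-- The low frequency part of a function in `L²`. -/
def lowFreq (K : ℝ) (u : L2 d) : L2 d :=
  𝓕⁻ (((Lp.memLp (𝓕 u : L2 d)).indicator
    (Metric.isOpen_ball (x := (0 : EuclideanSpace ℝ (Fin d))) (ε := K)).measurableSet).toLp _)

/-- By Plancherel, Fourier inversion over the ball is a pairing of `u` with an `L²` vector depending
only on `x` and `K`. Weak convergence of `u` thus gives pointwise convergence of its low frequency
part. -/
lemma lowFreq_ae_eq (K : ℝ) (u : L2 d) :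
    lowFreq K u =ᵐ[volume] fun x ↦ ⟪(𝓕⁻ ((memLp_cutWave K x).toLp _) : L2 d), u⟫_ℂ := by
  have hw := (Lp.memLp (𝓕 u : L2 d)).indicator
    (Metric.isOpen_ball (x := (0 : EuclideanSpace ℝ (Fin d))) (ε := K)).measurableSet
  have hw₁ : Integrable ((Metric.ball (0 : EuclideanSpace ℝ (Fin d)) K).indicator
      (𝓕 u : L2 d)) := by
    rw [integrable_indicator_iff Metric.isOpen_ball.measurableSet]
    have : IsFiniteMeasure (volume.restrict (Metric.ball (0 : EuclideanSpace ℝ (Fin d)) K)) :=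
      ⟨by simpa using measure_ball_lt_top⟩
    exact ((Lp.memLp (𝓕 u : L2 d)).restrict _).integrable (by norm_num)
  refine (fourierInv_toLp_ae_eq hw₁ hw).trans (ae_of_all _ fun x ↦ ?_)
  beta_reduce
  rw [← Lp.inner_fourier_eq, FourierTransform.fourier_fourierInv_eq, L2.inner_def,
    Real.fourierInv_eq]
  refine integral_congr_ae ?_
  filter_upwards [(memLp_cutWave K x).coeFn_toLp] with ξ hξ
  rw [hξ, cutWave]
  by_cases h : ξ ∈ Metric.ball (0 : EuclideanSpace ℝ (Fin d)) K
  · simp [h, Circle.smul_def, mul_comm, AddChar.map_neg_eq_inv]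
  · simp [h]

/-- The bound is uniform in `x`, which supplies the dominating constant in
`tendsto_setIntegral_lowFreq`. -/
lemma norm_fourierInv_cutWave_le (K : ℝ) (x : EuclideanSpace ℝ (Fin d)) :
    ‖(𝓕⁻ ((memLp_cutWave K x).toLp _) : L2 d)‖ ≤ ‖(memLp_indicator_ball (d := d) K).toLp _‖ := by
  rw [← Lp.norm_fourier_eq, FourierTransform.fourier_fourierInv_eq]
  refine Lp.norm_le_norm_of_ae_le ?_
  filter_upwards [(memLp_cutWave K x).coeFn_toLp, (memLp_indicator_ball K).coeFn_toLp] with ξ h h'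
  rw [h, h']
  exact norm_cutWave_le K x ξ

lemma fourier_sub (u v : L2 d) : (𝓕 (u - v) : L2 d) = 𝓕 u - 𝓕 v :=
  (Lp.fourierTransformₗᵢ (EuclideanSpace ℝ (Fin d)) ℂ).map_sub u v

lemma norm_sub_lowFreq_sq (K : ℝ) (u : L2 d) :
    ‖u - lowFreq K u‖ ^ 2 = ∫ ξ in (Metric.ball 0 K)ᶜ, ‖(𝓕 u : L2 d) ξ‖ ^ 2 := by
  have hw := (Lp.memLp (𝓕 u : L2 d)).indicator
    (Metric.isOpen_ball (x := (0 : EuclideanSpace ℝ (Fin d))) (ε := K)).measurableSet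
  rw [← Lp.norm_fourier_eq, fourier_sub, lowFreq,
    FourierTransform.fourier_fourierInv_eq, norm_sq_eq_integral,
    ← integral_indicator Metric.isOpen_ball.measurableSet.compl]
  refine integral_congr_ae ?_
  filter_upwards [Lp.coeFn_sub (𝓕 u : L2 d) (hw.toLp _), hw.coeFn_toLp] with ξ h h'
  rw [h, Pi.sub_apply, h']
  by_cases hξ : ξ ∈ Metric.ball (0 : EuclideanSpace ℝ (Fin d)) K
  · simp [hξ]
  · simp [hξ]

/-- The low frequency parts of a weakly null sequence tend to zero in `L²` on bounded sets. -/
lemma tendsto_setIntegral_lowFreq {u : ℕ → L2 d} {M : ℝ} (hM : ∀ n, ‖u n‖ ≤ M)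
    (hu : ∀ w : L2 d, Tendsto (fun n ↦ ⟪w, u n⟫_ℂ) atTop (𝓝 0)) (K R : ℝ) :
    Tendsto (fun n ↦ ∫ x in Metric.ball 0 R, ‖lowFreq K (u n) x‖ ^ 2) atTop (𝓝 0) := by
  have h := tendsto_integral_of_dominated_convergence
    (μ := volume.restrict (Metric.ball (0 : EuclideanSpace ℝ (Fin d)) R))
    (F := fun n x ↦ ‖lowFreq K (u n) x‖ ^ 2) (f := fun _ ↦ 0)
    (fun _ ↦ (‖(memLp_indicator_ball (d := d) K).toLp _‖ * M) ^ 2)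
    (fun n ↦ (integrable_norm_sq _).aestronglyMeasurable.restrict)
    (integrableOn_const measure_ball_lt_top.ne) (fun n ↦ ?_) ?_
  · simpa using h
  · refine ae_restrict_of_ae ?_
    filter_upwards [lowFreq_ae_eq K (u n)] with x hx
    rw [hx, Real.norm_of_nonneg (by positivity)]
    gcongr
    refine (norm_inner_le_norm _ _).trans ?_
    gcongr
    · exact norm_fourierInv_cutWave_le K x
    · exact hM n
  · refine ae_restrict_of_ae ?_
    filter_upwards [ae_all_iff.2 fun n ↦ lowFreq_ae_eq K (u n)] with x hx
    simp only [hx]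
    simpa using (hu (𝓕⁻ ((memLp_cutWave K x).toLp _))).norm.pow 2

/-- **Rellich's theorem**: a weakly null sequence in `L²` with bounded gradients tends to zero in
`L²` on bounded sets. -/
theorem tendsto_setIntegral_ball {u : ℕ → L2 d} {g : ℕ → Fin d → L2 d}
    (hg : ∀ n i, IsWeakPartial i (u n) (g n i)) {M C : ℝ} (hM : ∀ n, ‖u n‖ ≤ M)
    (hC : ∀ n, ∑ i, ‖g n i‖ ^ 2 ≤ C)
    (hu : ∀ w : L2 d, Tendsto (fun n ↦ ⟪w, u n⟫_ℂ) atTop (𝓝 0)) (R : ℝ) :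
    Tendsto (fun n ↦ ∫ x in Metric.ball 0 R, ‖u n x‖ ^ 2) atTop (𝓝 0) := by
  have hC0 : 0 ≤ C := (Finset.sum_nonneg fun i _ ↦ by positivity).trans (hC 0)
  -- Split at frequency `K` and use `(a + b)² ≤ 2a² + 2b²`. The high frequency error `C / K²` is
  -- uniform in `n`, so `K` can be fixed before `n` grows.
  have key : ∀ K : ℝ, 0 < K → ∀ n, ∫ x in Metric.ball 0 R, ‖u n x‖ ^ 2 ≤
      2 * (∫ x in Metric.ball 0 R, ‖lowFreq K (u n) x‖ ^ 2) + 2 * (C / K ^ 2) := by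
    intro K hK n
    have h₁ : ‖u n - lowFreq K (u n)‖ ^ 2 ≤ C / K ^ 2 := by
      rw [norm_sub_lowFreq_sq]
      refine (setIntegral_fourier_le (hg n) hK).trans ?_
      gcongr
      exact hC n
    have h₂ : ∫ x in Metric.ball 0 R, ‖(u n - lowFreq K (u n) : L2 d) x‖ ^ 2 ≤ C / K ^ 2 := by
      refine le_trans ?_ h₁
      rw [norm_sq_eq_integral]
      exact setIntegral_le_integral (integrable_norm_sq _) (ae_of_all _ fun x ↦ by positivity)
    calc ∫ x in Metric.ball 0 R, ‖u n x‖ ^ 2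
        ≤ ∫ x in Metric.ball 0 R, (2 * ‖lowFreq K (u n) x‖ ^ 2 +
            2 * ‖(u n - lowFreq K (u n) : L2 d) x‖ ^ 2) := by
          refine setIntegral_mono_ae (integrable_norm_sq _).integrableOn
            (((integrable_norm_sq _).const_mul _).add
              ((integrable_norm_sq _).const_mul _)).integrableOn ?_
          filter_upwards [Lp.coeFn_sub (u n) (lowFreq K (u n))] with x hx
          rw [hx, Pi.sub_apply]
          have := norm_le_norm_add_norm_sub (lowFreq K (u n) x) (u n x)
          rw [norm_sub_rev] at this
          nlinarith [norm_nonneg (u n x), sq_nonneg (‖lowFreq K (u n) x‖ -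
            ‖u n x - lowFreq K (u n) x‖)]
      _ = 2 * (∫ x in Metric.ball 0 R, ‖lowFreq K (u n) x‖ ^ 2) +
            2 * ∫ x in Metric.ball 0 R, ‖(u n - lowFreq K (u n) : L2 d) x‖ ^ 2 := by
          rw [integral_add ((integrable_norm_sq _).const_mul _).integrableOn
            ((integrable_norm_sq _).const_mul _).integrableOn, integral_const_mul,
            integral_const_mul]
      _ ≤ _ := by gcongr
  rw [Metric.tendsto_atTop']
  intro ε hε
  have hKlim : Tendsto (fun K : ℝ ↦ 2 * (C / K ^ 2)) atTop (𝓝 0) := by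
    simpa using ((tendsto_pow_atTop (α := ℝ) two_ne_zero).const_div_atTop C).const_mul 2
  obtain ⟨K, hK, hK0⟩ := ((hKlim.eventually (gt_mem_nhds (half_pos hε))).and
    (eventually_gt_atTop 0)).exists
  have hlow := (tendsto_setIntegral_lowFreq hM hu K R).const_mul 2
  rw [mul_zero] at hlow
  obtain ⟨N, hN⟩ := eventually_atTop.1 (hlow.eventually (gt_mem_nhds (half_pos hε)))
  refine ⟨N, fun n hn ↦ ?_⟩
  rw [Real.dist_eq, sub_zero, abs_of_nonneg (setIntegral_nonneg
    Metric.isOpen_ball.measurableSet fun x _ ↦ by positivity)]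
  linarith [key K hK0 n, hN n hn.le]

/-! ### Distributional supports, weak compactness and the potential -/

/-- A function in `L²` vanishes almost everywhere off its distributional support. -/
lemma ae_eq_zero_of_dsupport_subset {E : Set (EuclideanSpace ℝ (Fin d))} {f : L2 d}
    (hf : Distribution.dsupport (f : 𝓢'(EuclideanSpace ℝ (Fin d), ℂ)) ⊆ E) :
    ∀ᵐ x, x ∉ E → f x = 0 := by
  have hloc : ∀ x ∈ Eᶜ, ∃ s ∈ 𝓝[Eᶜ] x, ∀ᵐ y ∂volume, y ∈ s → f y = 0 := by
    intro x hx
    obtain ⟨s, hs, hso, hxs⟩ := (Distribution.notMem_dsupport_iff _).1 fun h ↦ hx (hf h)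
    refine ⟨s, mem_nhdsWithin_of_mem_nhds (hso.mem_nhds hxs), ?_⟩
    refine hso.ae_eq_zero_of_integral_contDiff_smul_eq_zero
      (((Lp.memLp f).locallyIntegrable (by norm_num)).locallyIntegrableOn _) fun g hg hc hgs ↦ ?_
    have hg₁ : HasCompactSupport (Complex.ofRealCLM ∘ g) := hc.comp_left rfl
    have hg₂ : ContDiff ℝ ∞ (Complex.ofRealCLM ∘ g) := by fun_prop
    have hg₃ : tsupport (hg₁.toSchwartzMap hg₂) ⊆ s :=
      (tsupport_comp_subset (map_zero Complex.ofRealCLM) g).trans hgs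
    have := hs _ hg₃
    rw [Lp.toTemperedDistribution_apply] at this
    simpa using! this
  -- Second countability glues the local statements; `E` need not be closed.
  have hnull : volume ({x | f x ≠ 0} ∩ Eᶜ) = 0 := by
    refine measure_null_of_locally_null _ fun x hx ↦ ?_
    obtain ⟨s, hs, hfs⟩ := hloc x hx.2
    refine ⟨s ∩ ({x | f x ≠ 0} ∩ Eᶜ), inter_mem (nhdsWithin_mono x Set.inter_subset_right hs)
      self_mem_nhdsWithin, ?_⟩
    refine measure_mono_null ?_ (ae_iff.1 hfs)
    exact fun y hy h ↦ hy.2.1 (h hy.1)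
  filter_upwards [measure_eq_zero_iff_ae_notMem.1 hnull] with x hx hxE
  by_contra h
  exact hx ⟨h, hxE⟩

lemma dsupport_subset_of_ae_eq_zero {E : Set (EuclideanSpace ℝ (Fin d))} (hE : IsClosed E)
    {f : L2 d} (hf : ∀ᵐ x, x ∉ E → f x = 0) :
    Distribution.dsupport (f : 𝓢'(EuclideanSpace ℝ (Fin d), ℂ)) ⊆ E := by
  refine Set.sInter_subset_of_mem ⟨fun φ hφ ↦ ?_, hE⟩
  rw [Lp.toTemperedDistribution_apply]
  refine integral_eq_zero_of_ae ?_
  filter_upwards [hf] with x hx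
  by_cases hxE : x ∈ E
  · have : φ x = 0 := by
      by_contra h
      exact hφ (subset_tsupport _ h) hxE
    simp [this]
  · simp [hx hxE]

/-- Bounded sequences in a separable Hilbert space have weakly convergent subsequences. -/
lemma exists_subseq_tendsto_inner {X : Type*} [NormedAddCommGroup X] [InnerProductSpace ℂ X]
    [CompleteSpace X] [TopologicalSpace.SeparableSpace X] {k : ℕ → X} {M : ℝ} (hk : ∀ n, ‖k n‖ ≤ M) :
    ∃ (x : X) (φ : ℕ → ℕ), StrictMono φ ∧
      ∀ w, Tendsto (fun n ↦ ⟪w, k (φ n)⟫_ℂ) atTop (𝓝 ⟪w, x⟫_ℂ) := by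
  -- Sequential Banach–Alaoglu, transported by the Riesz isomorphism; its antilinearity explains the
  -- conjugations below.
  obtain ⟨ψ, -, φ, hφ, hlim⟩ := WeakDual.isSeqCompact_closedBall ℂ X 0 M
    (x := fun n ↦ StrongDual.toWeakDual (InnerProductSpace.toDual ℂ X (k n)))
    fun n ↦ by simpa using hk n
  obtain ⟨x, hx⟩ := (InnerProductSpace.toDual ℂ X).surjective (WeakDual.toStrongDual ψ)
  refine ⟨x, φ, hφ, fun w ↦ ?_⟩
  have h := ((WeakDual.eval_continuous w).tendsto ψ).comp hlim
  have h' := (Complex.continuous_conj.tendsto _).comp h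
  have e : ψ w = ⟪x, w⟫_ℂ := by
    rw [← InnerProductSpace.toDual_apply_apply, hx]
    rfl
  rw [e, inner_conj_symm] at h'
  refine h'.congr fun n ↦ ?_
  exact inner_conj_symm _ _

lemma exists_forall_le_of_liminf_pos {V : EuclideanSpace ℝ (Fin d) → ℝ}
    (hV : 0 < liminf (fun x ↦ (V x : EReal)) (cocompact (EuclideanSpace ℝ (Fin d)))) :
    ∃ c > 0, ∃ R, ∀ x, x ∉ Metric.ball 0 R → c ≤ V x := by
  obtain ⟨c, hc, hcV⟩ := EReal.lt_iff_exists_real_btwn.1 hV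
  have h := eventually_lt_of_lt_liminf hcV
  rw [← Metric.cobounded_eq_cocompact, hasBasis_cobounded_norm.eventually_iff] at h
  obtain ⟨R, -, hR⟩ := h
  refine ⟨c, by exact_mod_cast hc, R, fun x hx ↦ ?_⟩
  have := hR (show x ∈ {x | R ≤ ‖x‖} by simpa using hx)
  exact_mod_cast this.le

lemma norm_sqrtMul_sq {V : EuclideanSpace ℝ (Fin d) → ℝ} (hV : ∀ x, 0 ≤ V x)
    (u : formDomain V) : ‖sqrtMul V u‖ ^ 2 = ∫ x, V x * ‖(u : L2 d) x‖ ^ 2 := by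
  rw [norm_sq_eq_integral]
  refine integral_congr_ae ?_
  filter_upwards [sqrtMul_ae_eq V u] with x hx
  rw [← hx, norm_mul, mul_pow, Complex.norm_real, Real.norm_eq_abs, sq_abs, Real.sq_sqrt (hV x)]

lemma integrable_mul_norm_sq {V : EuclideanSpace ℝ (Fin d) → ℝ} (hV : ∀ x, 0 ≤ V x)
    (u : formDomain V) : Integrable fun x ↦ V x * ‖(u : L2 d) x‖ ^ 2 := by
  refine (integrable_norm_sq (sqrtMul V u)).congr ?_
  filter_upwards [sqrtMul_ae_eq V u] with x hx
  rw [← hx, norm_mul, mul_pow, Complex.norm_real, Real.norm_eq_abs, sq_abs, Real.sq_sqrt (hV x)]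

/-- The potential controls the mass outside of a ball. -/
lemma setIntegral_compl_ball_le {V : EuclideanSpace ℝ (Fin d) → ℝ} (hV : ∀ x, 0 ≤ V x)
    {c R : ℝ} (hc : 0 < c) (hcV : ∀ x, x ∉ Metric.ball 0 R → c ≤ V x) (u : formDomain V) :
    ∫ x in (Metric.ball 0 R)ᶜ, ‖(u : L2 d) x‖ ^ 2 ≤ ‖sqrtMul V u‖ ^ 2 / c := by
  rw [norm_sqrtMul_sq hV, ← integral_div]
  refine (setIntegral_mono_on (integrable_norm_sq _).integrableOn
    ((integrable_mul_norm_sq hV u).div_const c).integrableOn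
    Metric.isOpen_ball.measurableSet.compl fun x hx ↦ ?_).trans
    (setIntegral_le_integral ((integrable_mul_norm_sq hV u).div_const c)
      (ae_of_all _ fun x ↦ div_nonneg (mul_nonneg (hV x) (by positivity)) hc.le))
  rw [le_div_iff₀ hc, mul_comm]
  gcongr
  exact hcV x hx

/-- Links vanishing potential energy to support in the zero set; both directions of the theorem use
it. -/
lemma sqrtMul_eq_zero_iff {V : EuclideanSpace ℝ (Fin d) → ℝ} (hV : ∀ x, 0 ≤ V x)
    (u : formDomain V) : sqrtMul V u = 0 ↔ ∀ᵐ x, x ∉ V ⁻¹' {0} → (u : L2 d) x = 0 := by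
  rw [Lp.eq_zero_iff_ae_eq_zero]
  constructor
  · intro h
    filter_upwards [h, sqrtMul_ae_eq V u] with x hx hx' hxV
    rw [hx, Pi.zero_apply, mul_eq_zero] at hx'
    refine hx'.resolve_left fun h0 ↦ hxV ?_
    exact (Real.sqrt_eq_zero (hV x)).1 (by exact_mod_cast h0)
  · intro h
    filter_upwards [h, sqrtMul_ae_eq V u] with x hx hx'
    rw [← hx', Pi.zero_apply, mul_eq_zero]
    by_cases h0 : V x = 0
    · simp [h0]
    · exact .inr (hx h0)

lemma secondCountableTopology_ambient (d : ℕ) : SecondCountableTopology (Ambient d) :=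
  have : Fact ((2 : ℝ≥0∞) ≠ ⊤) := ⟨ENNReal.ofNat_ne_top⟩
  have : SecondCountableTopology (L2 d) := Lp.SecondCountableTopology
  (PiLp.homeomorph 2 fun _ : Option (Option (Fin d)) ↦ L2 d).secondCountableTopology

/-! ### The compactness argument -/

/-- A sequence of normalized functions with bounded gradients and potential energies tending to
zero has a nonzero limit point in `H¹` supported in the zero set of the potential. -/
theorem not_oneNull_of_tendsto {V : EuclideanSpace ℝ (Fin d) → ℝ} (hV : Continuous V)
    (hV_nonneg : ∀ x, 0 ≤ V x)
    (hV_liminf : 0 < liminf (fun x ↦ (V x : EReal)) (cocompact (EuclideanSpace ℝ (Fin d))))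
    {u : ℕ → formDomain V} (hu : ∀ n, ‖(u n : L2 d)‖ = 1) {C : ℝ}
    (hC : ∀ n, ∑ i, ‖formPartial V i (u n)‖ ^ 2 ≤ C)
    (hlim : Tendsto (fun n ↦ ‖sqrtMul V (u n)‖) atTop (𝓝 0)) :
    ¬ OneNull (V ⁻¹' {0}) := by
  intro hnull
  -- Weak limits are taken in the energy space for `h = 1`, one fixed Hilbert space for the whole
  -- sequence.
  have := completeSpace_range_energyMap one_ne_zero V
  obtain ⟨B, hB⟩ := hlim.bddAbove_range
  have hbound : ∀ n, ‖(energyMap 1 V).rangeRestrict (u n)‖ ≤ √(1 + (B ^ 2 + C)) := by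
    intro n
    refine Real.le_sqrt_of_sq_le ?_
    rw [norm_sq_rangeRestrict_energyMap, hu]
    have h₁ : ‖sqrtMul V (u n)‖ ≤ B := hB ⟨n, rfl⟩
    have h₂ : ‖sqrtMul V (u n)‖ ^ 2 ≤ B ^ 2 := by gcongr
    linarith [hC n]
  have := secondCountableTopology_ambient d
  obtain ⟨k, φ, hφ, hk⟩ := exists_subseq_tendsto_inner hbound
  obtain ⟨v, rfl⟩ := (energyMap 1 V).surjective_rangeRestrict k
  have hweak : ∀ (j : Option (Option (Fin d))) (w : L2 d),
      Tendsto (fun n ↦ ⟪w, energyMap 1 V (u (φ n)) j⟫_ℂ) atTop (𝓝 ⟪w, energyMap 1 V v j⟫_ℂ) := by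
    intro j w
    let T : LinearMap.range (energyMap 1 V) →L[ℂ] L2 d :=
      PiLp.proj 2 (fun _ : Option (Option (Fin d)) ↦ L2 d) j ∘L Submodule.subtypeL _
    have h := hk (ContinuousLinearMap.adjoint T w)
    simp only [ContinuousLinearMap.adjoint_inner_left] at h
    exact h
  -- The potential components converge weakly to that of `v` and strongly to zero.
  have hsqrt : sqrtMul V v = 0 := by
    refine ext_inner_left ℂ fun w ↦ ?_
    refine tendsto_nhds_unique (hweak (some none) w) ?_
    rw [inner_zero_right]
    have : Tendsto (fun n ↦ sqrtMul V (u (φ n))) atTop (𝓝 0) :=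
      tendsto_zero_iff_norm_tendsto_zero.2 (hlim.comp hφ.tendsto_atTop)
    simpa using (tendsto_const_nhds (x := w)).inner (𝕜 := ℂ) this
  have hv : (v : L2 d) = 0 := hnull v v.2.1 (dsupport_subset_of_ae_eq_zero
    (isClosed_singleton.preimage hV) ((sqrtMul_eq_zero_iff hV_nonneg v).1 hsqrt))
  obtain ⟨c, hc, R, hR⟩ := exists_forall_le_of_liminf_pos hV_liminf
  have h₁ : Tendsto (fun n ↦ ∫ x in Metric.ball 0 R, ‖(u (φ n) : L2 d) x‖ ^ 2) atTop (𝓝 0) := by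
    refine tendsto_setIntegral_ball (u := fun n ↦ (u (φ n) : L2 d))
      (g := fun n i ↦ formPartial V i (u (φ n))) (M := 1) (C := C)
      (fun n i ↦ isWeakPartial_weakPartial i ⟨u (φ n), (u (φ n)).2.1⟩)
      (fun n ↦ (hu (φ n)).le) (fun n ↦ hC (φ n)) (fun w ↦ ?_) R
    simpa [hv] using hweak none w
  have h₂ : Tendsto (fun n ↦ ‖sqrtMul V (u (φ n))‖ ^ 2 / c) atTop (𝓝 0) := by
    simpa using ((hlim.comp hφ.tendsto_atTop).pow 2).div_const c
  have h₃ : ∀ n, 1 ≤ (∫ x in Metric.ball 0 R, ‖(u (φ n) : L2 d) x‖ ^ 2) +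
      ‖sqrtMul V (u (φ n))‖ ^ 2 / c := by
    intro n
    have h := norm_sq_eq_integral (u (φ n) : L2 d)
    rw [hu, one_pow, ← integral_add_compl Metric.isOpen_ball.measurableSet
      (integrable_norm_sq _)] at h
    rw [h]
    gcongr
    exact setIntegral_compl_ball_le hV_nonneg hc hR _
  have h₄ := ge_of_tendsto' (h₁.add h₂) h₃
  norm_num at h₄

/-- If the zero set of the potential is 1-null, then the form of `-h²Δ + V` is bounded from below
by any multiple of `h²`, for small `h`. -/
theorem eventually_forall_le_form {V : EuclideanSpace ℝ (Fin d) → ℝ} (hV : Continuous V)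
    (hV_nonneg : ∀ x, 0 ≤ V x)
    (hV_liminf : 0 < liminf (fun x ↦ (V x : EReal)) (cocompact (EuclideanSpace ℝ (Fin d))))
    (hnull : OneNull (V ⁻¹' {0})) (C : ℝ) :
    ∀ᶠ h : ℝ in 𝓝[>] 0, ∀ u : formDomain V, C * h ^ 2 * ‖(u : L2 d)‖ ^ 2 ≤
      ‖sqrtMul V u‖ ^ 2 + h ^ 2 * ∑ i, ‖formPartial V i u‖ ^ 2 := by
  by_contra hcon
  -- Negating "eventually" gives `hₙ → 0⁺` along which the bound fails for some vector, which is
  -- then normalized.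
  obtain ⟨h, hlim, hh⟩ := exists_seq_forall_of_frequently
    ((not_eventually.1 hcon).and_eventually eventually_mem_nhdsWithin)
  have hlim' : Tendsto h atTop (𝓝 0) := hlim.mono_right nhdsWithin_le_nhds
  have hex : ∀ n, ∃ u : formDomain V, ‖(u : L2 d)‖ = 1 ∧
      ‖sqrtMul V u‖ ^ 2 + h n ^ 2 * ∑ i, ‖formPartial V i u‖ ^ 2 ≤ C * h n ^ 2 := by
    intro n
    obtain ⟨u, hu⟩ := not_forall.1 (hh n).1
    rw [not_le] at hu
    have hu0 : ‖(u : L2 d)‖ ≠ 0 := by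
      intro h0
      have hu' : u = 0 := Subtype.ext (norm_eq_zero.1 h0)
      simp [hu'] at hu
    set t : ℂ := ((‖(u : L2 d)‖⁻¹ : ℝ) : ℂ) with ht
    have htn : ‖t‖ = ‖(u : L2 d)‖⁻¹ := by
      rw [ht, Complex.norm_real, Real.norm_of_nonneg (by positivity)]
    refine ⟨t • u, ?_, ?_⟩
    · rw [Submodule.coe_smul, norm_smul, htn, inv_mul_cancel₀ hu0]
    · simp only [map_smul, norm_smul, mul_pow, htn, ← Finset.mul_sum]
      have hpos : 0 < ‖(u : L2 d)‖ ^ 2 := by positivity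
      rw [mul_left_comm, ← mul_add, inv_pow, inv_mul_le_iff₀ hpos]
      linarith
  choose u hu₁ hu₂ using hex
  refine not_oneNull_of_tendsto hV hV_nonneg hV_liminf hu₁ (C := C) (fun n ↦ ?_) ?_ hnull
  · have hpos : 0 < h n ^ 2 := pow_pos (hh n).2 2
    refine le_of_mul_le_mul_left ?_ hpos
    linarith [hu₂ n, sq_nonneg ‖sqrtMul V (u n)‖]
  · have hsq : Tendsto (fun n ↦ ‖sqrtMul V (u n)‖ ^ 2) atTop (𝓝 0) := by
      refine squeeze_zero (fun n ↦ by positivity) (fun n ↦ ?_)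
        (g := fun n ↦ C * h n ^ 2) (by simpa using (hlim'.pow 2).const_mul C)
      have : 0 ≤ h n ^ 2 * ∑ i, ‖formPartial V i (u n)‖ ^ 2 := by positivity
      linarith [hu₂ n]
    simpa using hsq.sqrt

end Schrodinger

end

/-! ### The equivalence -/

theorem mainTheorem1 (d : ℕ) (V : EuclideanSpace ℝ (Fin d) → ℝ) (hV : Continuous V)
    (hV_nonneg : ∀ x, 0 ≤ V x) (hV_min : ∃ x, V x = 0)
    (hV_liminf : 0 < Filter.liminf (fun x ↦ (V x : EReal))
      (Filter.cocompact (EuclideanSpace ℝ (Fin d)))) :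
    Schrodinger.OneNull (V ⁻¹' {0}) ↔
      Filter.Tendsto
        (fun h : ℝ ↦ UnboundedOperator.firstEigenvalue (Schrodinger.schrodinger h V) /
          ((h ^ 2 : ℝ) : EReal))
        (𝓝[>] 0) (𝓝 ⊤) := by
  constructor
  · intro hnull
    rw [EReal.tendsto_nhds_top_iff_real]
    intro x
    -- The constant `max x 0 + 1` exceeds `x` and is nonnegative, as the lower bound requires.
    filter_upwards [Schrodinger.eventually_forall_le_form hV hV_nonneg hV_liminf hnull
      (max x 0 + 1), eventually_mem_nhdsWithin] with h hh hpos
    have hpos : 0 < h := hpos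
    have key := Schrodinger.le_firstEigenvalue_schrodinger hpos.ne' hV
      (c := (max x 0 + 1) * h ^ 2) (by positivity) hh
    have h₂ : ((max x 0 + 1 : ℝ) : EReal) ≤
        UnboundedOperator.firstEigenvalue (Schrodinger.schrodinger h V) /
          ((h ^ 2 : ℝ) : EReal) := by
      rw [EReal.le_div_iff_mul_le (by exact_mod_cast pow_pos hpos 2) (EReal.coe_ne_top _)]
      exact_mod_cast key
    refine lt_of_lt_of_le ?_ h₂
    exact_mod_cast (le_max_left x 0).trans_lt (lt_add_one _)
  · intro hlim f hf hsupp
    by_contra hf0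
    have hae := Schrodinger.ae_eq_zero_of_dsupport_subset hsupp
    have hz : (fun x ↦ (√(V x) : ℂ) * f x) =ᵐ[volume] 0 := by
      filter_upwards [hae] with x hx
      by_cases h0 : V x = 0
      · simp [h0]
      · simp [hx h0]
    -- `V` may be unbounded, but `V^{1/2} f = 0` almost everywhere puts `f` in the form domain.
    let u : Schrodinger.formDomain V := ⟨f, hf, (memLp_congr_ae hz).2 MemLp.zero⟩
    have hu : Schrodinger.sqrtMul V u = 0 := (Schrodinger.sqrtMul_eq_zero_iff hV_nonneg u).2 hae
    have hu0 : u ≠ 0 := fun h ↦ hf0 (congrArg Subtype.val h)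
    rw [EReal.tendsto_nhds_top_iff_real] at hlim
    -- The level is the Rayleigh quotient of `f` divided by `h²`, which is independent of `h`.
    obtain ⟨h, hh, hpos⟩ := ((hlim ((∑ i, ‖Schrodinger.formPartial V i u‖ ^ 2) / ‖f‖ ^ 2)).and
      eventually_mem_nhdsWithin).exists
    have hpos : 0 < h := hpos
    have key := Schrodinger.firstEigenvalue_schrodinger_le hpos.ne' hV u hu0
    rw [hu, norm_zero, zero_pow two_ne_zero, zero_add, mul_comm, mul_div_right_comm] at key
    refine hh.not_ge ?_
    rw [EReal.div_le_iff_le_mul (by exact_mod_cast pow_pos hpos 2) (EReal.coe_ne_top _)]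
    rw [mul_comm]
    exact_mod_cast key
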